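/- **Setting.** Let $\mathcal S,\mathcal A$ be compact Polish spaces and let $(\mathcal S,\mathcal A,P,r,\rho,\gamma)$ be an infinite-horizon discounted Markov decision process with Markov transition kernel $P(\cdot|s,a)$, continuous reward $r:\mathcal S\times\mathcal A\to\mathbb R$, initial state distribution $\rho$ and discount factor $\gamma\in[0,1)$. A policy is a (measurable) map $s\mapsto\pi(\cdot|s)$ from states to probability measures on $\mathcal A$; $\Pi$ is the set of policies. Let $J(\pi)=\mathbb E_{\rho,\pi}[\sum_{t\ge 0}\gamma^t r(s_t,a_t)]$, let $V^\pi(s)$ and $Q^\pi(s,a)$ be the state-value and action-value functions, $A^\pi(s,a)=Q^\pi(s,a)-V^\pi(s)$ the advantage function, and $\rho_\pi=(1-\gamma)\sum_{t\ge0}\gamma^t\,\mathbb P_{\rho,\pi}(s_t\in\cdot)$ the (normalized) discounted state-occupancy measure. Let $c:\mathcal A\times\mathcal A\to\mathbb R_{\ge0}$ be a continuous transport cost with $c(a,a)=0$ for all $a$, and let $C(\mu,\nu)=\min_{\eta}\int c\,d\eta$ be the associated optimal transport discrepancy, the minimum being over the couplings $\eta$ of $\mu$ and $\nu$. For $\varepsilon>0$,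 $\pi\in\Pi$ and a measurable function $\hat A:\mathcal S\times\mathcal A\to\mathbb R$ consider $$\text{(P)}\quad \sup_{\tilde\pi\in\Pi}\Big\{\int_{\mathcal S}\int_{\mathcal A}\hat A(s,a)\,d\tilde\pi(a|s)\,d\rho_\pi(s)\;:\;\int_{\mathcal S} C(\pi(\cdot|s),\tilde\pi(\cdot|s))\,d\rho_\pi(s)\le\varepsilon\Big\},$$ $$\text{(D)}\quad \min_{\lambda\ge0}\Big\{\lambda\varepsilon+\int_{\mathcal S}\int_{\mathcal A}\sup_{a'\in\mathcal A}\{\hat A(s,a')-\lambda c(a,a')\}\,d\pi(a|s)\,d\rho_\pi(s)\Big\}.$$ Put $\mathcal D_\lambda(s,a)=\operatorname{argmax}_{a'\in\mathcal A}\{\hat A(s,a')-\lambda c(a,a')\}$. An *optimal update* of $\pi$ with radius $\varepsilon$, computed with $\hat A$ and with dual minimizer $\lambda^*$, is a solution $\tilde\pi^*$ of (P) which, for some solution $\lambda^*\ge 0$ of (D), has the closed form $$\tilde\pi^*(\cdot|s)=t^*\,\underline T(s,\cdot)_\#\pi(\cdot|s)+(1-t^*)\,\overline T(s,\cdot)_\#\pi(\cdot|s)\qquad\text{for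 every } s\in\mathcal S,$$ where $\underline T,\overline T:\mathcal S\times\mathcal A\to\mathcal A$ are measurable, $\underline T(s,a)\in\operatorname{argmin}_{a'\in\mathcal D_{\lambda^*}(s,a)}c(a,a')$ and $\overline T(s,a)\in\operatorname{argmax}_{a'\in\mathcal D_{\lambda^*}(s,a)}c(a,a')$ for all $(s,a)$, and $t^*\in[0,1]$ satisfies, if $\lambda^*>0$, $$t^*\int_{\mathcal S}\int_{\mathcal A} c(a,\underline T(s,a))\,d\pi(a|s)\,d\rho_\pi(s)+(1-t^*)\int_{\mathcal S}\int_{\mathcal A} c(a,\overline T(s,a))\,d\pi(a|s)\,d\rho_\pi(s)=\varepsilon .$$ **Proposition (Performance improvement).** Let $\varepsilon>0$ and $\pi\in\Pi$, and let $\hat A$ be an estimate of $A^\pi$ with $\|A^\pi-\hat A\|_\infty<\infty$. If $\tilde\pi^*$ is an optimal update of $\pi$ computed with $\hat A$, with dual minimizer $\lambda^*$, then $\int_{\mathcal S} C(\pi(\cdot|s),\tilde\pi^*(\cdot|s))\,d\rho_{\tilde\pi^*}(s)<\infty$ and $$J(\tilde\pi^*)\ \ge\ J(\pi)+\frac{\lambda^*}{1-\gamma}\int_{\mathcal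 S} C(\pi(\cdot|s),\tilde\pi^*(\cdot|s))\,d\rho_{\tilde\pi^*}(s)-\frac{2\|A^\pi-\hat A\|_\infty}{1-\gamma}.$$ In particular, with exact advantages the updates improve performance monotonically: if $\pi_0,\pi_1,\dots$ are policies such that each $\pi_{k+1}$ is an optimal update of $\pi_k$ computed with $\hat A=A^{\pi_k}$ (for some radius $\varepsilon_k>0$), then $J(\pi_0)\le J(\pi_1)\le\cdots$. -/

import Mathlib

open MeasureTheory ProbabilityTheory Set
open scoped ENNReal

noncomputable section

namespace OTTRPO

/-- An infinite-horizon discounted Markov decision process with state space `S`, action space `A`,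
transition probability kernel `trans`, reward `reward`, initial state distribution `init` and
discount factor `γ ∈ [0, 1)`. -/
structure MDP (S A : Type*) [MeasurableSpace S] [MeasurableSpace A] where
  trans : Kernel (S × A) S
  markov_trans : IsMarkovKernel trans
  reward : S → A → ℝ
  init : Measure S
  prob_init : IsProbabilityMeasure init
  γ : ℝ
  γ_nonneg : 0 ≤ γ
  γ_lt_one : γ < 1

/-- Randomized stationary Markovian policies: (measurable) maps sending a state to a probability
measure on actions. -/
structure Policy (S A : Type*) [MeasurableSpace S] [MeasurableSpace A] where
  kernel : Kernel S A
  markov_kernel : IsMarkovKernel kernel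

attribute [instance] MDP.markov_trans MDP.prob_init Policy.markov_kernel

variable {S A : Type*} [MeasurableSpace S] [MeasurableSpace A]

/-- The probability measure `π(·|s)` on the action space. -/
abbrev Policy.at (π : Policy S A) (s : S) : Measure A := π.kernel s

namespace MDP

/-- One step of the state-action chain: from `(s, a)` draw `s' ∼ P(·|s,a)`, then `a' ∼ π(·|s')`. -/
def step (M : MDP S A) (π : Policy S A) : Kernel (S × A) (S × A) :=
  M.trans.compProd (Kernel.prodMkLeft (S × A) π.kernel)

instance (M : MDP S A) (π : Policy S A) : IsMarkovKernel (M.step π) := by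
  unfold step; infer_instance

/-- The step kernel as a function of the whole history up to time `n` (it only uses time `n`). -/
def historyStep (M : MDP S A) (π : Policy S A) (n : ℕ) :
    Kernel ((i : Finset.Iic n) → S × A) (S × A) :=
  (M.step π).comap (fun h => h ⟨n, Finset.mem_Iic.2 le_rfl⟩) (measurable_pi_apply _)

instance (M : MDP S A) (π : Policy S A) (n : ℕ) : IsMarkovKernel (M.historyStep π n) := by
  unfold historyStep; infer_instance

/-- The law of the trajectory `(s_t, a_t)_{t ∈ ℕ}` of the MDP controlled by `π`, when the first
pair `(s_0, a_0)` has law `μ`. -/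
def pathLaw (M : MDP S A) (π : Policy S A) (μ : Measure (S × A)) : Measure (ℕ → S × A) :=
  Kernel.trajMeasure (X := fun _ => S × A) μ (M.historyStep π)

/-- The discounted return `∑ γ^t r(s_t, a_t)` of a trajectory. -/
def discountedReturn (M : MDP S A) (ω : ℕ → S × A) : ℝ :=
  ∑' t : ℕ, M.γ ^ t * M.reward (ω t).1 (ω t).2

/-- The performance `J(π)`: `s_0` is drawn from the initial distribution, `a_0 ∼ π(·|s_0)`. -/
def J (M : MDP S A) (π : Policy S A) : ℝ :=
  ∫ ω, M.discountedReturn ω ∂(M.pathLaw π (M.init.compProd π.kernel))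

/-- The state-value function `V^π`: `s_0 = s`, `a_0 ∼ π(·|s)`. -/
def V (M : MDP S A) (π : Policy S A) (s : S) : ℝ :=
  ∫ ω, M.discountedReturn ω ∂(M.pathLaw π ((Measure.dirac s).compProd π.kernel))

/-- The action-value function `Q^π`: `s_0 = s`, `a_0 = a`. -/
def Q (M : MDP S A) (π : Policy S A) (s : S) (a : A) : ℝ :=
  ∫ ω, M.discountedReturn ω ∂(M.pathLaw π (Measure.dirac (s, a)))

/-- The advantage function `A^π = Q^π - V^π`. -/
def advantage (M : MDP S A) (π : Policy S A) (s : S) (a : A) : ℝ :=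
  M.Q π s a - M.V π s

/-- The (normalized) discounted state-occupancy measure
`ρ_π = (1 - γ) ∑ γ^t ℙ_{ρ,π}(s_t ∈ ·)`. -/
def occupancy (M : MDP S A) (π : Policy S A) : Measure S :=
  Measure.sum fun t : ℕ => ENNReal.ofReal ((1 - M.γ) * M.γ ^ t) •
    (M.pathLaw π (M.init.compProd π.kernel)).map (fun ω => (ω t).1)

end MDP

/-- Joint measures with marginals `μ` and `ν`. -/
def couplings (μ ν : Measure A) : Set (Measure (A × A)) :=
  {g | g.map Prod.fst = μ ∧ g.map Prod.snd = ν}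

/-- The optimal transport discrepancy `C(μ, ν)` for the transport cost `c`. -/
def otDiscrepancy (c : A → A → ℝ) (μ ν : Measure A) : ℝ≥0∞ :=
  ⨅ g ∈ couplings μ ν, ∫⁻ z, ENNReal.ofReal (c z.1 z.2) ∂g

/-- The sup norm `‖f‖_∞` of a function of state and action. -/
def supNorm (f : S → A → ℝ) : ℝ := ⨆ z : S × A, |f z.1 z.2|

section Problems

/- `adv` is the (estimated) advantage function used to compute the update. -/
variable (M : MDP S A) (c : A → A → ℝ) (ε : ℝ) (π : Policy S A) (adv : S → A → ℝ)

/-- The trust region: policies whose average transport discrepancy from `π` is at most `ε`. -/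
def trustRegion : Set (Policy S A) :=
  {π' | ∫⁻ s, otDiscrepancy c (π.at s) (π'.at s) ∂(M.occupancy π) ≤ ENNReal.ofReal ε}

/-- The objective of the primal problem. -/
def primalObjective (π' : Policy S A) : ℝ :=
  ∫ s, ∫ a, adv s a ∂(π'.at s) ∂(M.occupancy π)

/-- `π'` solves the primal (trust-region constrained) problem. -/
def IsPrimalSolution (π' : Policy S A) : Prop :=
  π' ∈ trustRegion M c ε π ∧
    ∀ π'' ∈ trustRegion M c ε π, primalObjective M π adv π'' ≤ primalObjective M π adv π'

/-- The regularized advantage `Φ_λ(s, a) = max_{a'} {A(s, a') - λ c(a, a')}`. -/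
def regAdvantage (lam : ℝ) (s : S) (a : A) : ℝ := ⨆ a', (adv s a' - lam * c a a')

/-- The set `D_λ(s, a)` of maximizers defining `Φ_λ(s, a)`. -/
def maximizers (lam : ℝ) (s : S) (a : A) : Set A :=
  {a' | ∀ b, adv s b - lam * c a b ≤ adv s a' - lam * c a a'}

/-- The objective of the dual problem. -/
def dualObjective (lam : ℝ) : ℝ :=
  lam * ε + ∫ s, ∫ a, regAdvantage c adv lam s a ∂(π.at s) ∂(M.occupancy π)

/-- `lam` solves the dual problem. -/
def IsDualSolution (lam : ℝ) : Prop :=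
  0 ≤ lam ∧ ∀ lam', 0 ≤ lam' → dualObjective M c ε π adv lam ≤ dualObjective M c ε π adv lam'

/-- `π'` has the closed form `t T_# π(·|s) + (1 - t) T'_# π(·|s)`, where `T` and `T'` are measurable
selections of the closest and of the furthest element of `D_λ(s, a)`, and where `t ∈ [0, 1]`
makes the average transport cost equal to `ε` if `λ > 0`. -/
def IsClosedFormUpdate (lam : ℝ) (π' : Policy S A) : Prop :=
  ∃ (Tlow Tup : S → A → A) (t : ℝ),
    Measurable (Function.uncurry Tlow) ∧ Measurable (Function.uncurry Tup) ∧
    (∀ s a, Tlow s a ∈ maximizers c adv lam s a ∧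
      ∀ b ∈ maximizers c adv lam s a, c a (Tlow s a) ≤ c a b) ∧
    (∀ s a, Tup s a ∈ maximizers c adv lam s a ∧
      ∀ b ∈ maximizers c adv lam s a, c a b ≤ c a (Tup s a)) ∧
    t ∈ Icc (0 : ℝ) 1 ∧
    (0 < lam →
      t * (∫ s, ∫ a, c a (Tlow s a) ∂(π.at s) ∂(M.occupancy π)) +
        (1 - t) * (∫ s, ∫ a, c a (Tup s a) ∂(π.at s) ∂(M.occupancy π)) = ε) ∧
    ∀ s, π'.at s = ENNReal.ofReal t • (π.at s).map (Tlow s) +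
      ENNReal.ofReal (1 - t) • (π.at s).map (Tup s)

/-- `π'` is the optimal policy update of `π` in the trust region of radius `ε`, computed with the
advantage `adv`, and `lam` is the corresponding dual minimizer. -/
structure IsOptimalUpdate (lam : ℝ) (π' : Policy S A) : Prop where
  dual : IsDualSolution M c ε π adv lam
  primal : IsPrimalSolution M c ε π adv π'
  closedForm : IsClosedFormUpdate M c ε π adv lam π'

end Problems

end OTTRPO

end

/-! Two facts combine. The performance difference lemma (`J_sub_J_eq_integral_occupancy`) writes
`J(π') - J(π)` as `(1 - γ)⁻¹` times the integral of `A^π` against `π'(·|s)` and the occupancy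
measure of the new policy `π'`. It is a telescoping argument: along the chain of `π'`, `A^π` is the
reward minus `V^π - γ K V^π`, and the discounted sum of the latter collapses to `V^π`
(`discountedValue_sub_integral`).

The update gains at every single state. An action `b` in `D_λ(s, a)` is at least as good as staying
at `a`, which costs nothing, so `adv s b ≥ adv s a + λ c(a, b)` (`le_of_mem_maximizers`). Averaging
over the mixture of the two transport maps gives a gain of at least `λ κ(s)`, where `κ(s)` is the
cost of an explicit coupling and hence dominates the discrepancy (`IsClosedFormUpdate.exists_cost`).
Since this holds for each `s`, it may be integrated against the occupancy of `π'` although the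
update was designed with that of `π`. As `A^π` has mean zero under `π`, only the estimation error is
lost, once under `π` and once under `π'`. -/

noncomputable section

namespace OTTRPO

/-! ### Integrals of bounded measurable functions against kernels. -/

section Bounded

variable {X Y : Type*} [MeasurableSpace X] [MeasurableSpace Y]

lemma integrable_of_abs_le {μ : Measure X} [IsFiniteMeasure μ] {f : X → ℝ} {C : ℝ}
    (hf : Measurable f) (hC : ∀ x, |f x| ≤ C) : Integrable f μ :=
  Integrable.of_bound hf.aestronglyMeasurable C (ae_of_all _ hC)

lemma abs_integral_le_of_abs_le {μ : Measure X} [IsProbabilityMeasure μ] {f : X → ℝ} {C : ℝ}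
    (hC : ∀ x, |f x| ≤ C) : |∫ x, f x ∂μ| ≤ C := by
  simpa using norm_integral_le_of_norm_le_const (μ := μ) (f := f) (ae_of_all _ hC)

lemma measurable_integral_kernel (K : Kernel X Y) [IsSFiniteKernel K] {f : Y → ℝ}
    (hf : Measurable f) : Measurable fun x => ∫ y, f y ∂(K x) :=
  hf.stronglyMeasurable.integral_kernel.measurable

lemma measurable_integral_kernel_uncurry (K : Kernel X Y) [IsSFiniteKernel K] {f : X → Y → ℝ}
    (hf : Measurable (Function.uncurry f)) : Measurable fun x => ∫ y, f x y ∂(K x) :=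
  hf.stronglyMeasurable.integral_kernel_prod_right'.measurable

lemma integral_comp_measure (K : Kernel X Y) [IsMarkovKernel K] (μ : Measure X)
    [IsProbabilityMeasure μ] {f : Y → ℝ} {C : ℝ} (hf : Measurable f) (hC : ∀ x, |f x| ≤ C) :
    ∫ y, f y ∂(K ∘ₘ μ) = ∫ x, ∫ y, f y ∂(K x) ∂μ := by
  have hi : Integrable f (K ∘ₘ μ) := integrable_of_abs_le hf hC
  rw [Measure.comp_eq_comp_const_apply] at hi ⊢
  rw [Kernel.integral_comp hi, Kernel.const_apply]

end Bounded

instance isMarkovKernel_pow {X : Type*} [MeasurableSpace X] (K : Kernel X X) [IsMarkovKernel K]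
    (n : ℕ) : IsMarkovKernel (K ^ n) := by
  induction n with
  | zero => rw [pow_zero]; exact inferInstanceAs (IsMarkovKernel Kernel.id)
  | succ n ih => rw [pow_succ]; exact inferInstanceAs (IsMarkovKernel ((K ^ n) ∘ₖ K))

/-! ### Discounted sums along a Markov chain. -/

section DiscountedValue

variable {X : Type*} [MeasurableSpace X] (K : Kernel X X) [IsMarkovKernel K] (γ : ℝ)

/-- The expected discounted sum `∑ γ^t 𝔼 f(x_t)` along the Markov chain with kernel `K` started
at `x`. -/
def discountedValue (f : X → ℝ) (x : X) : ℝ := ∑' t : ℕ, γ ^ t * ∫ y, f y ∂((K ^ t) x)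

variable {γ} {f : X → ℝ} {C : ℝ}

lemma abs_pow_mul_le (hγ : 0 ≤ γ) {a : ℝ} (ha : |a| ≤ C) (t : ℕ) : |γ ^ t * a| ≤ γ ^ t * C := by
  rw [abs_mul, abs_of_nonneg (pow_nonneg hγ t)]
  exact mul_le_mul_of_nonneg_left ha (pow_nonneg hγ t)

lemma hasSum_pow_mul_const (hγ : 0 ≤ γ) (hγ1 : γ < 1) :
    HasSum (fun t : ℕ => γ ^ t * C) ((1 - γ)⁻¹ * C) :=
  (hasSum_geometric_of_lt_one hγ hγ1).mul_right C

lemma summable_pow_mul_of_abs_le (hγ : 0 ≤ γ) (hγ1 : γ < 1) {a : ℕ → ℝ} (ha : ∀ t, |a t| ≤ C) :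
    Summable fun t => γ ^ t * a t :=
  Summable.of_norm_bounded (hasSum_pow_mul_const hγ hγ1).summable
    fun t => abs_pow_mul_le hγ (ha t) t

lemma abs_tsum_pow_mul_le (hγ : 0 ≤ γ) (hγ1 : γ < 1) {a : ℕ → ℝ} (ha : ∀ t, |a t| ≤ C) :
    |∑' t, γ ^ t * a t| ≤ (1 - γ)⁻¹ * C := by
  rw [← Real.norm_eq_abs]
  exact tsum_of_norm_bounded (hasSum_pow_mul_const hγ hγ1) fun t => abs_pow_mul_le hγ (ha t) t

lemma measurable_tsum_pow_mul (hγ : 0 ≤ γ) (hγ1 : γ < 1) {Y : Type*} [MeasurableSpace Y]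
    {a : ℕ → Y → ℝ}
    (hm : ∀ t, Measurable (a t)) (ha : ∀ t y, |a t y| ≤ C) :
    Measurable fun y => ∑' t, γ ^ t * a t y := by
  refine measurable_of_tendsto_metrizable (f := fun n y => ∑ t ∈ Finset.range n, γ ^ t * a t y)
    (fun n => Finset.measurable_fun_sum _ fun t _ => (hm t).const_mul _) ?_
  exact tendsto_pi_nhds.2 fun y =>
    (summable_pow_mul_of_abs_le hγ hγ1 fun t => ha t y).hasSum.tendsto_sum_nat

lemma integral_tsum_pow_mul (hγ : 0 ≤ γ) (hγ1 : γ < 1) {Y : Type*} [MeasurableSpace Y]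
    (μ : Measure Y)
    [IsProbabilityMeasure μ] {a : ℕ → Y → ℝ}
    (hm : ∀ t, Measurable (a t)) (ha : ∀ t y, |a t y| ≤ C) :
    ∫ y, ∑' t, γ ^ t * a t y ∂μ = ∑' t, γ ^ t * ∫ y, a t y ∂μ := by
  have hb : ∀ t y, |γ ^ t * a t y| ≤ γ ^ t * C := fun t y => abs_pow_mul_le hγ (ha t y) t
  rw [← integral_tsum_of_summable_integral_norm]
  · simp_rw [integral_const_mul]
  · exact fun t => integrable_of_abs_le ((hm t).const_mul _) (hb t)
  · refine Summable.of_norm_bounded (hasSum_pow_mul_const hγ hγ1 (C := C)).summable fun t => ?_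
    exact abs_integral_le_of_abs_le fun y => by simpa using hb t y

lemma abs_discountedValue_le (hγ : 0 ≤ γ) (hγ1 : γ < 1) (hC : ∀ x, |f x| ≤ C) (x : X) :
    |discountedValue K γ f x| ≤ (1 - γ)⁻¹ * C :=
  abs_tsum_pow_mul_le hγ hγ1 fun _ => abs_integral_le_of_abs_le hC

lemma measurable_discountedValue (hγ : 0 ≤ γ) (hγ1 : γ < 1) (hf : Measurable f)
    (hC : ∀ x, |f x| ≤ C) :
    Measurable (discountedValue K γ f) :=
  measurable_tsum_pow_mul hγ hγ1 (fun t => measurable_integral_kernel (K ^ t) hf)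
    fun _ _ => abs_integral_le_of_abs_le hC

lemma integral_discountedValue (hγ : 0 ≤ γ) (hγ1 : γ < 1) (μ : Measure X)
    [IsProbabilityMeasure μ] (hf : Measurable f)
    (hC : ∀ x, |f x| ≤ C) :
    ∫ x, discountedValue K γ f x ∂μ = ∑' t : ℕ, γ ^ t * ∫ y, f y ∂((K ^ t) ∘ₘ μ) := by
  simp_rw [integral_comp_measure _ μ hf hC]
  exact integral_tsum_pow_mul hγ hγ1 μ (fun t => measurable_integral_kernel (K ^ t) hf)
    fun _ _ => abs_integral_le_of_abs_le hC

/-- The tail is kept in terms of `K ^ (t + 1)` because it is read in two ways: as `K` followed by `K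
^ t` for the Bellman equation, and as `K ^ t` followed by `K` for the telescoping below. -/
lemma discountedValue_eq_add_tsum (hγ : 0 ≤ γ) (hγ1 : γ < 1) (hf : Measurable f)
    (hC : ∀ x, |f x| ≤ C) (x : X) :
    discountedValue K γ f x = f x + γ * ∑' t : ℕ, γ ^ t * ∫ y, f y ∂((K ^ (t + 1)) x) := by
  have hs := summable_pow_mul_of_abs_le hγ hγ1 (a := fun t => ∫ y, f y ∂((K ^ t) x))
    fun t => abs_integral_le_of_abs_le hC
  have h0 : ∫ y, f y ∂((K ^ 0) x) = f x := by
    rw [pow_zero]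
    change ∫ y, f y ∂(Kernel.id x) = f x
    rw [Kernel.id_apply, integral_dirac' _ _ hf.stronglyMeasurable]
  rw [discountedValue, hs.tsum_eq_zero_add, h0, ← tsum_mul_left]
  simp [pow_succ, mul_assoc, mul_comm]

/-- The Bellman equation. -/
lemma discountedValue_eq_add_integral (hγ : 0 ≤ γ) (hγ1 : γ < 1) (hf : Measurable f)
    (hC : ∀ x, |f x| ≤ C) (x : X) :
    discountedValue K γ f x = f x + γ * ∫ y, discountedValue K γ f y ∂(K x) := by
  rw [discountedValue_eq_add_tsum K hγ hγ1 hf hC, integral_discountedValue K hγ hγ1 _ hf hC]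
  congr 3

/-- Telescoping: `∑ γ^t K^t` inverts `1 - γ K` on bounded measurable functions. -/
lemma discountedValue_sub_integral (hγ : 0 ≤ γ) (hγ1 : γ < 1) (hf : Measurable f)
    (hC : ∀ x, |f x| ≤ C) (x : X) :
    discountedValue K γ (fun x => f x - γ * ∫ y, f y ∂(K x)) x = f x := by
  have hm := measurable_integral_kernel K hf
  have hK : ∀ x, |∫ y, f y ∂(K x)| ≤ C := fun x => abs_integral_le_of_abs_le hC
  have key : ∀ t, γ ^ t * ∫ y, (f y - γ * ∫ z, f z ∂(K y)) ∂((K ^ t) x)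
      = γ ^ t * (∫ y, f y ∂((K ^ t) x)) - γ * (γ ^ t * ∫ y, f y ∂((K ^ (t + 1)) x)) := by
    intro t
    have h : (K ^ (t + 1)) x = K ∘ₘ ((K ^ t) x) := by
      rw [pow_succ']; rfl
    rw [integral_sub (integrable_of_abs_le hf hC) ((integrable_of_abs_le hm hK).const_mul _),
      integral_const_mul, h, integral_comp_measure K _ hf hC]
    ring
  have hs := summable_pow_mul_of_abs_le hγ hγ1 (a := fun t => ∫ y, f y ∂((K ^ t) x))
    fun t => abs_integral_le_of_abs_le hC
  have hs' := summable_pow_mul_of_abs_le hγ hγ1 (a := fun t => ∫ y, f y ∂((K ^ (t + 1)) x))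
    fun t => abs_integral_le_of_abs_le hC
  have := discountedValue_eq_add_tsum K hγ hγ1 hf hC x
  rw [discountedValue] at this ⊢
  simp_rw [key]
  rw [hs.tsum_sub (hs'.mul_left γ), tsum_mul_left, this]
  ring

lemma discountedValue_sub (hγ : 0 ≤ γ) (hγ1 : γ < 1) {g : X → ℝ} {D : ℝ} (hf : Measurable f)
    (hC : ∀ x, |f x| ≤ C)
    (hg : Measurable g) (hD : ∀ x, |g x| ≤ D) (x : X) :
    discountedValue K γ (fun x => f x - g x) x
      = discountedValue K γ f x - discountedValue K γ g x := by
  simp_rw [discountedValue, integral_sub (integrable_of_abs_le hf hC) (integrable_of_abs_le hg hD),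
    mul_sub]
  exact (summable_pow_mul_of_abs_le hγ hγ1 fun t => abs_integral_le_of_abs_le hC).tsum_sub
    (summable_pow_mul_of_abs_le hγ hγ1 fun t => abs_integral_le_of_abs_le hD)

end DiscountedValue

variable {S A : Type*} [MeasurableSpace S] [MeasurableSpace A]

/-! ### Trajectories and value functions. -/

namespace MDP

variable (M : MDP S A) (π : Policy S A)

instance (μ : Measure (S × A)) [IsProbabilityMeasure μ] :
    IsProbabilityMeasure (M.pathLaw π μ) := by
  unfold pathLaw
  exact inferInstance

/-- The pair visited at time `t` has law `μ Kᵗ`, where `K` is the state-action kernel. -/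
lemma map_pathLaw (μ : Measure (S × A)) [IsProbabilityMeasure μ] (t : ℕ) :
    (M.pathLaw π μ).map (fun ω => ω t) = (M.step π ^ t) ∘ₘ μ := by
  induction t with
  | zero =>
    rw [pow_zero]
    change _ = Kernel.id ∘ₘ μ
    rw [Measure.id_comp]
    -- Evaluation at time `0` factors through the restriction to times `≤ 0`, where the partial
    -- trajectory kernel is the identity.
    have h : (fun ω : ℕ → S × A => ω 0) =
        (fun h : (i : Finset.Iic 0) → S × A => h ⟨0, Finset.mem_Iic.2 le_rfl⟩) ∘
          Preorder.frestrictLe (π := fun _ => S × A) 0 := rfl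
    rw [h, ← Measure.map_map (by fun_prop) (by fun_prop), pathLaw, Kernel.trajMeasure,
      Measure.map_comp _ _ (by fun_prop), Kernel.traj_map_frestrictLe, Kernel.partialTraj_self,
      Measure.id_comp, Measure.map_map (by fun_prop) (by fun_prop)]
    exact Measure.map_id
  | succ t ih =>
    -- The joint law of the history up to `t` and the next pair is a composition-product; its second
    -- marginal is the law at time `t + 1`. As `historyStep` reads only the last entry of the
    -- history, it can be composed with the law at time `t`.
    have h := congrArg Measure.snd
      (Kernel.map_frestrictLe_trajMeasure_compProd_eq_map_trajMeasure (X := fun _ => S × A)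
        (μ₀ := μ) (κ := M.historyStep π) (a := t))
    rw [Measure.snd_compProd, Measure.snd_map_prodMk (by fun_prop)] at h
    change (M.pathLaw π μ).map (fun ω => ω (t + 1)) = _
    rw [pathLaw, ← h, pow_succ']
    change _ = (M.step π ∘ₖ (M.step π ^ t)) ∘ₘ μ
    rw [← Measure.comp_assoc, ← ih, historyStep, ← Kernel.comp_deterministic_eq_comap,
      ← Measure.comp_assoc, Measure.deterministic_comp_eq_map, Measure.map_map (by fun_prop)
        (by fun_prop)]
    rfl

variable {M} {C : ℝ}

/-- The action-value function as a function of the state-action pair. -/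
def value (M : MDP S A) (π : Policy S A) : S × A → ℝ :=
  discountedValue (M.step π) M.γ fun z => M.reward z.1 z.2

/-- This removes path space from the argument: `J`, `V` and `Q` all become integrals of `value`
against the initial law. -/
lemma integral_discountedReturn (hm : Measurable fun z : S × A => M.reward z.1 z.2)
    (hC : ∀ z : S × A, |M.reward z.1 z.2| ≤ C) (μ : Measure (S × A)) [IsProbabilityMeasure μ] :
    ∫ ω, M.discountedReturn ω ∂(M.pathLaw π μ) = ∫ z, M.value π z ∂μ := by
  rw [value, integral_discountedValue _ M.γ_nonneg M.γ_lt_one μ hm hC]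
  unfold discountedReturn
  rw [integral_tsum_pow_mul M.γ_nonneg M.γ_lt_one _
    (a := fun t (ω : ℕ → S × A) => M.reward (ω t).1 (ω t).2)
    (fun t => hm.comp (measurable_pi_apply t)) (fun t ω => hC (ω t))]
  simp_rw [← map_pathLaw]
  refine tsum_congr fun t => ?_
  rw [integral_map (measurable_pi_apply t).aemeasurable hm.aestronglyMeasurable]

lemma measurable_value (hm : Measurable fun z : S × A => M.reward z.1 z.2)
    (hC : ∀ z : S × A, |M.reward z.1 z.2| ≤ C) : Measurable (M.value π) :=
  measurable_discountedValue _ M.γ_nonneg M.γ_lt_one hm hC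

lemma abs_value_le (hC : ∀ z : S × A, |M.reward z.1 z.2| ≤ C) (z : S × A) :
    |M.value π z| ≤ (1 - M.γ)⁻¹ * C :=
  abs_discountedValue_le _ M.γ_nonneg M.γ_lt_one hC z

lemma Q_eq_value (hm : Measurable fun z : S × A => M.reward z.1 z.2)
    (hC : ∀ z : S × A, |M.reward z.1 z.2| ≤ C) (s : S) (a : A) : M.Q π s a = M.value π (s, a) := by
  rw [Q, integral_discountedReturn π hm hC,
    integral_dirac' _ _ (measurable_value π hm hC).stronglyMeasurable]

lemma V_eq_integral_value (hm : Measurable fun z : S × A => M.reward z.1 z.2)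
    (hC : ∀ z : S × A, |M.reward z.1 z.2| ≤ C) (s : S) :
    M.V π s = ∫ a, M.value π (s, a) ∂(π.at s) := by
  rw [V, integral_discountedReturn π hm hC, Measure.integral_compProd
      (integrable_of_abs_le (measurable_value π hm hC) (abs_value_le π hC)),
    integral_dirac' _ _ (measurable_integral_kernel_uncurry π.kernel
      (f := fun s a => M.value π (s, a)) (measurable_value π hm hC)).stronglyMeasurable]

lemma measurable_V (hm : Measurable fun z : S × A => M.reward z.1 z.2)
    (hC : ∀ z : S × A, |M.reward z.1 z.2| ≤ C) : Measurable (M.V π) := by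
  rw [funext (V_eq_integral_value π hm hC)]
  exact measurable_integral_kernel_uncurry _ (f := fun s a => M.value π (s, a))
    (measurable_value π hm hC)

lemma abs_V_le (hm : Measurable fun z : S × A => M.reward z.1 z.2)
    (hC : ∀ z : S × A, |M.reward z.1 z.2| ≤ C) (s : S) : |M.V π s| ≤ (1 - M.γ)⁻¹ * C := by
  rw [V_eq_integral_value π hm hC]
  exact abs_integral_le_of_abs_le fun a => abs_value_le π hC (s, a)

lemma J_eq_integral_value (hm : Measurable fun z : S × A => M.reward z.1 z.2)
    (hC : ∀ z : S × A, |M.reward z.1 z.2| ≤ C) :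
    M.J π = ∫ z, M.value π z ∂(M.init.compProd π.kernel) := by
  rw [J, integral_discountedReturn π hm hC]

lemma J_eq_integral_V (hm : Measurable fun z : S × A => M.reward z.1 z.2)
    (hC : ∀ z : S × A, |M.reward z.1 z.2| ≤ C) : M.J π = ∫ s, M.V π s ∂M.init := by
  rw [J_eq_integral_value π hm hC, Measure.integral_compProd
    (integrable_of_abs_le (measurable_value π hm hC) (abs_value_le π hC))]
  simp_rw [V_eq_integral_value π hm hC]

lemma integral_step (z : S × A) {f : S × A → ℝ} {D : ℝ} (hf : Measurable f)
    (hD : ∀ z, |f z| ≤ D) :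
    ∫ y, f y ∂(M.step π z) = ∫ s, ∫ a, f (s, a) ∂(π.at s) ∂(M.trans z) := by
  have hi : Integrable f (M.step π z) := integrable_of_abs_le hf hD
  unfold step at hi ⊢
  rw [integral_compProd hi]
  rfl

/-! ### Advantages, occupancy measures and the performance difference. -/

lemma measurable_advantage (hm : Measurable fun z : S × A => M.reward z.1 z.2)
    (hC : ∀ z : S × A, |M.reward z.1 z.2| ≤ C) :
    Measurable fun z : S × A => M.advantage π z.1 z.2 := by
  simp_rw [advantage, Q_eq_value π hm hC]
  exact (measurable_value π hm hC).sub ((measurable_V π hm hC).comp measurable_fst)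

lemma abs_advantage_le (hm : Measurable fun z : S × A => M.reward z.1 z.2)
    (hC : ∀ z : S × A, |M.reward z.1 z.2| ≤ C) (z : S × A) :
    |M.advantage π z.1 z.2| ≤ (1 - M.γ)⁻¹ * C + (1 - M.γ)⁻¹ * C := by
  rw [advantage, Q_eq_value π hm hC]
  exact (abs_sub _ _).trans (add_le_add (abs_value_le π hC _) (abs_V_le π hm hC _))

lemma integral_advantage_self (hm : Measurable fun z : S × A => M.reward z.1 z.2)
    (hC : ∀ z : S × A, |M.reward z.1 z.2| ≤ C) (s : S) : ∫ a, M.advantage π s a ∂(π.at s) = 0 := by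
  simp_rw [advantage, Q_eq_value π hm hC]
  rw [integral_sub (integrable_of_abs_le (f := fun a => M.value π (s, a))
    ((measurable_value π hm hC).comp measurable_prodMk_left)
    fun a => abs_value_le π hC (s, a)) (integrable_const _), V_eq_integral_value π hm hC]
  simp

/-- The advantage of `π` expressed through the state-action kernel of any other policy. -/
lemma advantage_eq (hm : Measurable fun z : S × A => M.reward z.1 z.2)
    (hC : ∀ z : S × A, |M.reward z.1 z.2| ≤ C) (π' : Policy S A) (z : S × A) :
    M.advantage π z.1 z.2 = M.reward z.1 z.2 -
      (M.V π z.1 - M.γ * ∫ y, M.V π y.1 ∂(M.step π' z)) := by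
  have hV := measurable_V π hm hC
  rw [advantage, Q_eq_value π hm hC, value, discountedValue_eq_add_integral _ M.γ_nonneg
    M.γ_lt_one (f := fun z : S × A => M.reward z.1 z.2) hm hC]
  change _ + M.γ * ∫ y, M.value π y ∂_ - _ = _
  -- Both integrals reduce to that of `V^π` against the transition law: under `π` the next action
  -- averages `Q^π` to `V^π`, while `V^π` ignores the next action, so that `π'` plays no role.
  rw [integral_step π _ (measurable_value π hm hC) (abs_value_le π hC),
    integral_step π' _ (f := fun y => M.V π y.1) (hV.comp measurable_fst)
      fun y => abs_V_le π hm hC y.1]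
  simp_rw [← V_eq_integral_value π hm hC]
  simp
  ring

/-- By `advantage_eq`, the reward part sums to the value of `π'` and the remainder telescopes to
`V^π`. -/
lemma discountedValue_advantage (hm : Measurable fun z : S × A => M.reward z.1 z.2)
    (hC : ∀ z : S × A, |M.reward z.1 z.2| ≤ C) (π' : Policy S A) (z : S × A) :
    discountedValue (M.step π') M.γ (fun z => M.advantage π z.1 z.2) z
      = M.value π' z - M.V π z.1 := by
  have hV : Measurable fun z : S × A => M.V π z.1 := (measurable_V π hm hC).comp measurable_fst
  have hVb : ∀ z : S × A, |M.V π z.1| ≤ (1 - M.γ)⁻¹ * C := fun z => abs_V_le π hm hC z.1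
  simp_rw [advantage_eq π hm hC π']
  rw [discountedValue_sub _ M.γ_nonneg M.γ_lt_one (f := fun z : S × A => M.reward z.1 z.2) hm hC
      (g := fun z => M.V π z.1 - M.γ * ∫ y, M.V π y.1 ∂(M.step π' z))
      (hV.sub ((measurable_integral_kernel _ hV).const_mul _)) (D := (1 - M.γ)⁻¹ * C +
        M.γ * ((1 - M.γ)⁻¹ * C)) ?_,
    discountedValue_sub_integral _ M.γ_nonneg M.γ_lt_one (f := fun z : S × A => M.V π z.1) hV hVb]
  · rfl
  · intro z
    refine (abs_sub _ _).trans (add_le_add (hVb z) ?_)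
    rw [abs_mul, abs_of_nonneg M.γ_nonneg]
    exact mul_le_mul_of_nonneg_left (abs_integral_le_of_abs_le hVb) M.γ_nonneg

/-- Average `discountedValue_advantage` over the initial pair: the initial state has the same law
under both policies, so the `V^π` term gives `J(π)`. -/
lemma J_sub_J_eq_tsum (hm : Measurable fun z : S × A => M.reward z.1 z.2)
    (hC : ∀ z : S × A, |M.reward z.1 z.2| ≤ C) (π' : Policy S A) :
    M.J π' - M.J π = ∑' t : ℕ, M.γ ^ t * ∫ z, M.advantage π z.1 z.2
      ∂((M.step π' ^ t) ∘ₘ (M.init.compProd π'.kernel)) := by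
  have hV : Measurable fun z : S × A => M.V π z.1 := (measurable_V π hm hC).comp measurable_fst
  have hVi : Integrable (fun z : S × A => M.V π z.1) (M.init.compProd π'.kernel) :=
    integrable_of_abs_le hV fun z => abs_V_le π hm hC z.1
  rw [← integral_discountedValue _ M.γ_nonneg M.γ_lt_one _ (measurable_advantage π hm hC)
    (abs_advantage_le π hm hC)]
  simp_rw [discountedValue_advantage π hm hC π']
  rw [integral_sub (integrable_of_abs_le (measurable_value π' hm hC) (abs_value_le π' hC)) hVi,
    ← J_eq_integral_value π' hm hC, Measure.integral_compProd hVi, J_eq_integral_V π hm hC]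
  simp

/-- At each time the action is drawn from `π` given the current state. State-action integrals thus
reduce to the state marginals that make up the occupancy measure. -/
lemma compProd_fst_pow_step (t : ℕ) :
    (((M.step π ^ t) ∘ₘ (M.init.compProd π.kernel)).fst).compProd π.kernel
      = (M.step π ^ t) ∘ₘ (M.init.compProd π.kernel) := by
  cases t with
  | zero =>
    rw [pow_zero]
    change (Measure.fst (Kernel.id ∘ₘ _)).compProd _ = Kernel.id ∘ₘ _
    rw [Measure.id_comp, Measure.fst_compProd]
  | succ t =>
    rw [pow_succ']
    change (Measure.fst ((M.step π ∘ₖ _) ∘ₘ _)).compProd _ = (M.step π ∘ₖ _) ∘ₘ _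
    rw [← Measure.comp_assoc]
    generalize hν : (M.step π ^ t) ∘ₘ (M.init.compProd π.kernel) = ν
    have : IsProbabilityMeasure ν := by rw [← hν]; infer_instance
    have h : M.step π ∘ₘ ν = (M.trans ∘ₘ ν).compProd π.kernel := by
      ext B hB
      rw [Measure.bind_apply hB (Kernel.aemeasurable _), Measure.compProd_apply hB,
        Measure.lintegral_bind (Kernel.aemeasurable _)
          (Kernel.measurable_kernel_prodMk_left hB).aemeasurable]
      refine lintegral_congr fun z => ?_
      rw [step, Kernel.compProd_apply hB]
      rfl
    rw [h, Measure.fst_compProd]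

lemma occupancy_eq_sum : M.occupancy π = Measure.sum fun t : ℕ =>
    ENNReal.ofReal ((1 - M.γ) * M.γ ^ t) •
      ((M.step π ^ t) ∘ₘ (M.init.compProd π.kernel)).fst := by
  unfold occupancy
  congr! 3 with t
  rw [← map_pathLaw, Measure.fst, Measure.map_map (by fun_prop) (by fun_prop)]
  rfl

lemma weight_nonneg (t : ℕ) : 0 ≤ (1 - M.γ) * M.γ ^ t :=
  mul_nonneg (sub_nonneg.2 M.γ_lt_one.le) (pow_nonneg M.γ_nonneg t)

instance : IsProbabilityMeasure (M.occupancy π) := by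
  constructor
  rw [occupancy_eq_sum, Measure.sum_apply _ MeasurableSet.univ]
  simp only [Measure.smul_apply, measure_univ, smul_eq_mul, mul_one]
  rw [← ENNReal.ofReal_tsum_of_nonneg weight_nonneg
    ((summable_geometric_of_lt_one M.γ_nonneg M.γ_lt_one).mul_left _), tsum_mul_left,
    tsum_geometric_of_lt_one M.γ_nonneg M.γ_lt_one, mul_inv_cancel₀ (sub_pos.2 M.γ_lt_one).ne']
  simp

lemma integral_occupancy {g : S → ℝ} {D : ℝ} (hg : Measurable g) (hD : ∀ s, |g s| ≤ D) :
    ∫ s, g s ∂(M.occupancy π) = (1 - M.γ) * ∑' t : ℕ, M.γ ^ t *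
      ∫ s, g s ∂((M.step π ^ t) ∘ₘ (M.init.compProd π.kernel)).fst := by
  have hi : Integrable g (M.occupancy π) := integrable_of_abs_le hg hD
  rw [occupancy_eq_sum] at hi ⊢
  rw [integral_sum_measure hi, ← tsum_mul_left]
  refine tsum_congr fun t => ?_
  rw [integral_smul_measure, ENNReal.toReal_ofReal (weight_nonneg t), smul_eq_mul, mul_assoc]

/-- The performance difference lemma. -/
lemma J_sub_J_eq_integral_occupancy (hm : Measurable fun z : S × A => M.reward z.1 z.2)
    (hC : ∀ z : S × A, |M.reward z.1 z.2| ≤ C) (π' : Policy S A) :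
    M.J π' - M.J π = (1 - M.γ)⁻¹ *
      ∫ s, ∫ a, M.advantage π s a ∂(π'.at s) ∂(M.occupancy π') := by
  have hA := measurable_advantage π hm hC
  have hAb := abs_advantage_le π hm hC
  rw [J_sub_J_eq_tsum π hm hC, integral_occupancy π'
    (measurable_integral_kernel_uncurry π'.kernel (f := M.advantage π) hA)
    fun s => abs_integral_le_of_abs_le fun a => hAb (s, a),
    inv_mul_cancel_left₀ (sub_pos.2 M.γ_lt_one).ne']
  refine tsum_congr fun t => ?_
  conv_lhs => rw [← compProd_fst_pow_step]
  rw [Measure.integral_compProd (integrable_of_abs_le hA hAb)]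

end MDP

/-! ### Transport cost and gain of a closed-form update. -/

lemma otDiscrepancy_le_of_eq_mixture {c : A → A → ℝ} (hc : Measurable (Function.uncurry c))
    {μ ν : Measure A} {p q : ℝ≥0∞} (hpq : p + q = 1) {T U : A → A}
    (hT : Measurable T) (hU : Measurable U) (hν : ν = p • μ.map T + q • μ.map U) :
    otDiscrepancy c μ ν ≤
      p * ∫⁻ a, ENNReal.ofReal (c a (T a)) ∂μ + q * ∫⁻ a, ENNReal.ofReal (c a (U a)) ∂μ := by
  have hT' : Measurable fun a => (a, T a) := measurable_id.prodMk hT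
  have hU' : Measurable fun a => (a, U a) := measurable_id.prodMk hU
  have hc' : Measurable fun z : A × A => ENNReal.ofReal (c z.1 z.2) := hc.ennreal_ofReal
  -- The coupling is the mixture of the images of `μ` on the graphs of `T` and `U`; it need not be
  -- optimal, since only an upper bound is claimed.
  refine (iInf₂_le (p • μ.map (fun a => (a, T a)) + q • μ.map (fun a => (a, U a)))
    ⟨?_, ?_⟩).trans_eq ?_
  · rw [lintegral_add_measure, lintegral_smul_measure, lintegral_smul_measure,
      lintegral_map hc' hT', lintegral_map hc' hU']
    rfl
  · rw [Measure.map_add _ _ measurable_fst, Measure.map_smul, Measure.map_smul,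
      Measure.map_map measurable_fst hT', Measure.map_map measurable_fst hU']
    change p • μ.map id + q • μ.map id = μ
    rw [Measure.map_id, ← add_smul, hpq, one_smul]
  · rw [Measure.map_add _ _ measurable_snd, Measure.map_smul, Measure.map_smul,
      Measure.map_map measurable_snd hT', Measure.map_map measurable_snd hU', hν]
    rfl

/-- The competitor in the maximization is `a` itself, reached at zero cost. -/
lemma le_of_mem_maximizers {S A : Type*} {c : A → A → ℝ} (hc_self : ∀ a, c a a = 0)
    {adv : S → A → ℝ} {lam : ℝ}
    {s : S} {a b : A} (hb : b ∈ maximizers c adv lam s a) :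
    adv s a + lam * c a b ≤ adv s b := by
  have h := hb a
  rw [hc_self] at h
  linarith

lemma integral_mixture {μ ν : Measure A} [IsProbabilityMeasure μ] {t : ℝ} (ht : t ∈ Icc (0 : ℝ) 1)
    {T U : A → A} (hT : Measurable T) (hU : Measurable U)
    (hν : ν = ENNReal.ofReal t • μ.map T + ENNReal.ofReal (1 - t) • μ.map U)
    {f : A → ℝ} {C : ℝ} (hf : Measurable f) (hC : ∀ a, |f a| ≤ C) :
    ∫ a, f a ∂ν = t * ∫ a, f (T a) ∂μ + (1 - t) * ∫ a, f (U a) ∂μ := by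
  have := Measure.isProbabilityMeasure_map (μ := μ) hT.aemeasurable
  have := Measure.isProbabilityMeasure_map (μ := μ) hU.aemeasurable
  rw [hν, integral_add_measure
      ((integrable_of_abs_le hf hC).smul_measure ENNReal.ofReal_ne_top)
      ((integrable_of_abs_le hf hC).smul_measure ENNReal.ofReal_ne_top),
    integral_smul_measure, integral_smul_measure, ENNReal.toReal_ofReal ht.1,
    ENNReal.toReal_ofReal (sub_nonneg.2 ht.2), integral_map hT.aemeasurable hf.aestronglyMeasurable,
    integral_map hU.aemeasurable hf.aestronglyMeasurable]
  rfl

/-- A closed-form update has a measurable bounded transport cost `κ` that dominates the optimal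
transport discrepancy, and it gains at least `lam * κ` in the advantage it is computed with. -/
lemma IsClosedFormUpdate.exists_cost {M : MDP S A} {c : A → A → ℝ} {ε lam : ℝ} {π π' : Policy S A}
    {adv : S → A → ℝ} (h : IsClosedFormUpdate M c ε π adv lam π')
    (hc : Measurable (Function.uncurry c)) (hc_nonneg : ∀ a a', 0 ≤ c a a')
    (hc_self : ∀ a, c a a = 0) {B D : ℝ} (hB : ∀ a a', c a a' ≤ B)
    (hadv : Measurable (Function.uncurry adv)) (hD : ∀ s a, |adv s a| ≤ D) :
    ∃ κ : S → ℝ, Measurable κ ∧ (∀ s, 0 ≤ κ s) ∧ (∀ s, κ s ≤ B) ∧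
      (∀ s, otDiscrepancy c (π.at s) (π'.at s) ≤ ENNReal.ofReal (κ s)) ∧
      ∀ s, ∫ a, adv s a ∂(π.at s) + lam * κ s ≤ ∫ a, adv s a ∂(π'.at s) := by
  obtain ⟨T, U, t, hT, hU, hTmax, hUmax, ht, -, hπ'⟩ := h
  have ht' : 0 ≤ 1 - t := sub_nonneg.2 ht.2
  have hcabs : ∀ a a', |c a a'| ≤ B := fun a a' => by
    rw [abs_of_nonneg (hc_nonneg a a')]; exact hB a a'
  have hm : ∀ {W : S → A → A}, Measurable (Function.uncurry W) →
      Measurable (Function.uncurry fun s a => c a (W s a)) := fun hW =>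
    hc.comp (measurable_snd.prodMk hW)
  have hs : ∀ {W : S → A → A}, Measurable (Function.uncurry W) → ∀ s, Measurable (W s) :=
    fun hW s => hW.comp measurable_prodMk_left
  have hi : ∀ {W : S → A → A}, Measurable (Function.uncurry W) → ∀ s,
      Integrable (fun a => c a (W s a)) (π.at s) := fun hW s =>
    integrable_of_abs_le ((hm hW).comp measurable_prodMk_left) fun a => hcabs _ _
  have hadvs : ∀ s, Measurable (adv s) := fun s => hadv.comp measurable_prodMk_left
  have hnn : ∀ (W : S → A → A) s, 0 ≤ ∫ a, c a (W s a) ∂(π.at s) := fun W s =>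
    integral_nonneg fun a => hc_nonneg _ _
  have hle : ∀ (W : S → A → A) s, ∫ a, c a (W s a) ∂(π.at s) ≤ B := fun W s =>
    (le_abs_self _).trans (abs_integral_le_of_abs_le fun a => hcabs _ _)
  have hgain : ∀ {W : S → A → A}, Measurable (Function.uncurry W) →
      (∀ s a, W s a ∈ maximizers c adv lam s a) → ∀ s,
      ∫ a, adv s a ∂(π.at s) + lam * ∫ a, c a (W s a) ∂(π.at s)
        ≤ ∫ a, adv s (W s a) ∂(π.at s) := by
    intro W hW hmax s
    rw [← integral_const_mul, ← integral_add (integrable_of_abs_le (hadvs s) (hD s))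
      ((hi hW s).const_mul _)]
    exact integral_mono ((integrable_of_abs_le (hadvs s) (hD s)).add ((hi hW s).const_mul _))
      (integrable_of_abs_le ((hadvs s).comp (hs hW s)) fun a => hD s _)
      fun a => le_of_mem_maximizers hc_self (hmax s a)
  -- `κ s` is the cost of the mixture coupling of the two transport maps at the state `s`.
  refine ⟨fun s => t * (∫ a, c a (T s a) ∂(π.at s)) + (1 - t) * ∫ a, c a (U s a) ∂(π.at s),
    ((measurable_integral_kernel_uncurry _ (hm hT)).const_mul _).add
      ((measurable_integral_kernel_uncurry _ (hm hU)).const_mul _),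
    fun s => add_nonneg (mul_nonneg ht.1 (hnn T s)) (mul_nonneg ht' (hnn U s)), fun s => ?_,
    fun s => ?_, fun s => ?_⟩
  · calc _ ≤ t * B + (1 - t) * B :=
        add_le_add (mul_le_mul_of_nonneg_left (hle T s) ht.1)
          (mul_le_mul_of_nonneg_left (hle U s) ht')
      _ = B := by ring
  · refine (otDiscrepancy_le_of_eq_mixture hc ?_ (hs hT s) (hs hU s) (hπ' s)).trans_eq ?_
    · rw [← ENNReal.ofReal_add ht.1 ht']; simp
    · rw [ENNReal.ofReal_add (mul_nonneg ht.1 (hnn T s)) (mul_nonneg ht' (hnn U s)),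
        ENNReal.ofReal_mul ht.1, ENNReal.ofReal_mul ht',
        ofReal_integral_eq_lintegral_ofReal (hi hT s) (ae_of_all _ fun a => hc_nonneg _ _),
        ofReal_integral_eq_lintegral_ofReal (hi hU s) (ae_of_all _ fun a => hc_nonneg _ _)]
  · rw [integral_mixture ht (hs hT s) (hs hU s) (hπ' s) (hadvs s) (hD s)]
    have h1 := mul_le_mul_of_nonneg_left (hgain hT (fun s a => (hTmax s a).1) s) ht.1
    have h2 := mul_le_mul_of_nonneg_left (hgain hU (fun s a => (hUmax s a).1) s) ht'
    linear_combination h1 + h2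

/-! ### The performance bound. -/

lemma abs_integral_sub_integral_le {μ : Measure A} [IsProbabilityMeasure μ] {f g : A → ℝ}
    {C D N : ℝ} (hf : Measurable f) (hC : ∀ a, |f a| ≤ C) (hg : Measurable g)
    (hD : ∀ a, |g a| ≤ D) (h : ∀ a, |f a - g a| ≤ N) :
    |∫ a, f a ∂μ - ∫ a, g a ∂μ| ≤ N := by
  rw [← integral_sub (integrable_of_abs_le hf hC) (integrable_of_abs_le hg hD)]
  exact abs_integral_le_of_abs_le h

/-- The boundedness hypothesis matters: a real supremum over an unbounded set is `0` by default. -/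
lemma abs_le_supNorm {S A : Type*} {f : S → A → ℝ}
    (hf : BddAbove (Set.range fun z : S × A => |f z.1 z.2|))
    (s : S) (a : A) : |f s a| ≤ supNorm f :=
  le_ciSup hf (s, a)

/-- The performance bound for a bounded measurable reward and a bounded measurable cost. -/
theorem performance_bound (M : MDP S A) {R B : ℝ}
    (hr : Measurable fun z : S × A => M.reward z.1 z.2) (hR : ∀ z : S × A, |M.reward z.1 z.2| ≤ R)
    {c : A → A → ℝ} (hc : Measurable (Function.uncurry c)) (hB : ∀ a a', c a a' ≤ B)
    (hc_nonneg : ∀ a a', 0 ≤ c a a') (hc_self : ∀ a, c a a = 0) {ε : ℝ} {π : Policy S A}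
    {adv : S → A → ℝ} (hadv : Measurable (Function.uncurry adv))
    (hbdd : BddAbove (Set.range fun z : S × A => |M.advantage π z.1 z.2 - adv z.1 z.2|))
    {lam : ℝ} {π' : Policy S A} (h : IsOptimalUpdate M c ε π adv lam π') :
    (∫⁻ s, otDiscrepancy c (π.at s) (π'.at s) ∂(M.occupancy π')) ≠ ∞ ∧
      M.J π' ≥ M.J π
        + lam / (1 - M.γ) *
          (∫⁻ s, otDiscrepancy c (π.at s) (π'.at s) ∂(M.occupancy π')).toReal
        - 2 * supNorm (fun s a => M.advantage π s a - adv s a) / (1 - M.γ) := by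
  have hlam : 0 ≤ lam := h.dual.1
  have hdiff : ∀ s a, |M.advantage π s a - adv s a| ≤
      supNorm fun s a => M.advantage π s a - adv s a :=
    abs_le_supNorm (f := fun s a => M.advantage π s a - adv s a) hbdd
  generalize supNorm (fun s a => M.advantage π s a - adv s a) = N at hdiff ⊢
  have hA := M.measurable_advantage π hr hR
  obtain ⟨D, hAb⟩ : ∃ D, ∀ z : S × A, |M.advantage π z.1 z.2| ≤ D :=
    ⟨_, M.abs_advantage_le π hr hR⟩
  -- The estimate inherits a bound from `A^π`, being within `N` of it.
  have hD : ∀ s a, |adv s a| ≤ D + N := fun s a => by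
    have h1 := abs_le.1 (hdiff s a)
    have h2 := abs_le.1 (hAb (s, a))
    exact abs_le.2 ⟨by linarith, by linarith⟩
  obtain ⟨κ, hκ, hκ0, hκB, hκC, hκgain⟩ :=
    h.closedForm.exists_cost hc hc_nonneg hc_self hB hadv hD
  have hκi : Integrable κ (M.occupancy π') := integrable_of_abs_le hκ fun s => by
    rw [abs_of_nonneg (hκ0 s)]; exact hκB s
  -- Monotonicity of the lower integral needs no measurability of the discrepancy in `s`; the
  -- measurable `κ` takes over.
  have hle : ∫⁻ s, otDiscrepancy c (π.at s) (π'.at s) ∂(M.occupancy π')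
      ≤ ENNReal.ofReal (∫ s, κ s ∂(M.occupancy π')) := by
    rw [ofReal_integral_eq_lintegral_ofReal hκi (ae_of_all _ hκ0)]
    exact lintegral_mono hκC
  have hle' := ENNReal.toReal_le_of_le_ofReal (integral_nonneg hκ0) hle
  refine ⟨ne_top_of_le_ne_top ENNReal.ofReal_ne_top hle, ?_⟩
  have hint : ∀ (p : Policy S A) s,
      |∫ a, M.advantage π s a ∂(p.at s) - ∫ a, adv s a ∂(p.at s)| ≤ N := fun p s =>
    abs_integral_sub_integral_le (Measurable.of_uncurry_left (f := M.advantage π) hA)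
      (fun a => hAb (s, a))
      (hadv.comp measurable_prodMk_left) (hD s) (hdiff s)
  -- One `N` pays for exchanging `adv` and `A^π` under `π`, where `A^π` averages to zero, and the
  -- other under `π'`.
  have hpoint : ∀ s, lam * κ s - 2 * N ≤ ∫ a, M.advantage π s a ∂(π'.at s) := fun s => by
    have h1 := abs_le.1 (hint π s)
    have h2 := abs_le.1 (hint π' s)
    have h3 := hκgain s
    rw [M.integral_advantage_self π hr hR] at h1
    linarith
  have hmono : lam * (∫ s, κ s ∂(M.occupancy π')) - 2 * N
      ≤ ∫ s, ∫ a, M.advantage π s a ∂(π'.at s) ∂(M.occupancy π') := by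
    have := integral_mono (μ := M.occupancy π') ((hκi.const_mul lam).sub (integrable_const (2 * N)))
      (integrable_of_abs_le
        (measurable_integral_kernel_uncurry π'.kernel (f := M.advantage π) hA)
        fun s => abs_integral_le_of_abs_le fun a => hAb (s, a)) hpoint
    rwa [integral_sub' (hκi.const_mul lam) (integrable_const (2 * N)), integral_const_mul,
      integral_const, probReal_univ, one_smul] at this
  have hpd := M.J_sub_J_eq_integral_occupancy π hr hR π'
  have hγ : 0 ≤ (1 - M.γ)⁻¹ := inv_nonneg.2 (sub_nonneg.2 M.γ_lt_one.le)
  have h1 := mul_le_mul_of_nonneg_left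
    ((sub_le_sub_right (mul_le_mul_of_nonneg_left hle' hlam) (2 * N)).trans hmono) hγ
  rw [← hpd] at h1
  rw [div_eq_mul_inv, div_eq_mul_inv]
  linarith

end OTTRPO

end

theorem proposition1 {S A : Type*}
    [TopologicalSpace S] [PolishSpace S] [CompactSpace S] [MeasurableSpace S] [BorelSpace S]
    [TopologicalSpace A] [PolishSpace A] [CompactSpace A] [MeasurableSpace A] [BorelSpace A]
    (M : OTTRPO.MDP S A) (hr : Continuous (Function.uncurry M.reward))
    (c : A → A → ℝ) (hc : Continuous (Function.uncurry c))
    (hc_nonneg : ∀ a a', 0 ≤ c a a') (hc_self : ∀ a, c a a = 0) :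
    -- the performance bound, for an update computed with an estimated advantage
    (∀ (ε : ℝ) (_ : 0 < ε) (π : OTTRPO.Policy S A)
        (advHat : S → A → ℝ) (_ : Measurable (Function.uncurry advHat))
        (_ : BddAbove (Set.range fun z : S × A => |M.advantage π z.1 z.2 - advHat z.1 z.2|))
        (lam : ℝ) (π' : OTTRPO.Policy S A)
        (_ : OTTRPO.IsOptimalUpdate M c ε π advHat lam π'),
        (∫⁻ s, OTTRPO.otDiscrepancy c (π.at s) (π'.at s) ∂(M.occupancy π')) ≠ ∞ ∧
        M.J π' ≥ M.J π
          + lam / (1 - M.γ) *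
            (∫⁻ s, OTTRPO.otDiscrepancy c (π.at s) (π'.at s) ∂(M.occupancy π')).toReal
          - 2 * OTTRPO.supNorm (fun s a => M.advantage π s a - advHat s a) / (1 - M.γ)) ∧
    -- with exact advantages, the iterated updates improve the performance monotonically
    (∀ π : ℕ → OTTRPO.Policy S A,
        (∀ k, ∃ ε > 0, ∃ lam, OTTRPO.IsOptimalUpdate M c ε (π k) (M.advantage (π k)) lam
          (π (k + 1))) →
        Monotone fun k => M.J (π k)) := by
  -- Compactness and continuity supply the bounds on reward and cost.
  obtain ⟨R, hR⟩ := isCompact_univ.exists_bound_of_continuousOn hr.continuousOn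
  obtain ⟨B, hB⟩ := isCompact_univ.exists_bound_of_continuousOn hc.continuousOn
  have hR' : ∀ z : S × A, |M.reward z.1 z.2| ≤ R := fun z => hR z (mem_univ z)
  have hB' : ∀ a a', c a a' ≤ B := fun a a' => (le_abs_self _).trans (hB (a, a') (mem_univ _))
  have hrm : Measurable fun z : S × A => M.reward z.1 z.2 := hr.measurable
  refine ⟨fun ε _ π adv hadv hbdd lam π' h => OTTRPO.performance_bound M hrm hR' hc.measurable
    hB' hc_nonneg hc_self hadv hbdd h, fun π h => monotone_nat_of_le_succ fun k => ?_⟩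
  obtain ⟨ε, -, lam, h⟩ := h k
  have hbound := (OTTRPO.performance_bound M hrm hR' hc.measurable hB' hc_nonneg hc_self
    (adv := M.advantage (π k)) (M.measurable_advantage (π k) hrm hR')
    ⟨0, by rintro _ ⟨z, rfl⟩; simp⟩ h).2
  -- With exact advantages the error term vanishes, and the transport term is nonnegative.
  have hnorm : OTTRPO.supNorm (fun s a => M.advantage (π k) s a - M.advantage (π k) s a) = 0 := by
    simp [OTTRPO.supNorm]
  rw [hnorm] at hbound
  have hpos : 0 ≤ lam / (1 - M.γ) * (∫⁻ s, OTTRPO.otDiscrepancy c ((π k).at s)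
      ((π (k + 1)).at s) ∂(M.occupancy (π (k + 1)))).toReal :=
    mul_nonneg (div_nonneg h.dual.1 (sub_nonneg.2 M.γ_lt_one.le)) ENNReal.toReal_nonneg
  simp only [mul_zero, zero_div, sub_zero] at hbound
  linarith
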